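/- Let $r\ge 1$, $J=[-1,1]^r$, and $\overrightarrow{\mathscr P}=(p_1,\dots,p_r)$ with $1\le p_i<\infty$. For a Lebesgue measurable $f:J\to\mathbb R$ put $$\|f\|_{\overrightarrow{\mathscr P}}=\left(\int_{-1}^{1}\cdots\left(\int_{-1}^{1}\left(\int_{-1}^{1}|f(x_1,\dots,x_r)|^{p_1}\,dx_1\right)^{p_2/p_1}dx_2\right)^{p_3/p_2}\cdots\,dx_r\right)^{1/p_r}\in[0,\infty],$$ and let $L^{\overrightarrow{\mathscr P}}(J)$ be the set of all measurable $f:J\to\mathbb R$ with $\|f\|_{\overrightarrow{\mathscr P}}<\infty$. Let $m\ge 0$ and let $\rho:\mathbb R\to\mathbb R$ be a sigmoidal function of class $\mathcal D(m)$, that is, $\rho$ is measurable, $\lim_{x\to-\infty}\rho(x)=0$, $\lim_{x\to\infty}\rho(x)=1$, $\rho$ is non-decreasing, $\rho(x)=1$ for $x\ge m$, and $\rho(x)=0$ for $x\le -m$. Put $\Psi_\rho(x)=\rho(x+1)-\rho(x-1)$ for $x\in\mathbb R$, and $\Psi_\rho(\mathbf x)=\Psi_\rho(x_1)\cdots\Psi_\rho(x_r)$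 for $\mathbf x=(x_1,\dots,x_r)\in\mathbb R^r$. For $n\in\mathbb N$, $f\in L^{\overrightarrow{\mathscr P}}(J)$ and $\mathbf x\in J$ define the multivariate Kantorovich-type neural network operator $$K_n(f,\mathbf x)=\frac{\displaystyle\sum_{\mathbf k}\Big(n^r\int_{I_{\mathbf k,n}}f(\mathbf t)\,d\mathbf t\Big)\Psi_\rho(n\mathbf x-\mathbf k)}{\displaystyle\sum_{\mathbf k}\Psi_\rho(n\mathbf x-\mathbf k)},\qquad I_{\mathbf k,n}=\prod_{j=1}^{r}\Big[\frac{k_j}{n},\frac{k_j+1}{n}\Big],$$ where both sums run over all $\mathbf k=(k_1,\dots,k_r)\in\mathbb Z^r$ with $-n\le k_j\le n-1$ for every $j$, and the quotient is read as $0$ at points where the denominator vanishes. Then for every $f\in L^{\overrightarrow{\mathscr P}}(J)$, $$\lim_{n\to\infty}\|f-K_nf\|_{\overrightarrow{\mathscr P}}=0 .$$ -/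

import Mathlib

open MeasureTheory Filter
open scoped ENNReal Topology

namespace KantorovichNN

/-- The cube `[-1,1]^r`. -/
def cube (r : ℕ) : Set (Fin r → ℝ) := Set.Icc (fun _ => -1) (fun _ => 1)

/-- `ρ : ℝ → ℝ` is a sigmoidal function of class `D(m)`: it is measurable, tends to `0` at `-∞`
and to `1` at `+∞`, is non-decreasing, equals `1` on `[m, ∞)` and equals `0` on `(-∞, -m]`. -/
structure SigmoidalClass (m : ℝ) (ρ : ℝ → ℝ) : Prop where
  measurable : Measurable ρ
  tendsto_atBot : Tendsto ρ atBot (𝓝 0)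
  tendsto_atTop : Tendsto ρ atTop (𝓝 1)
  monotone : Monotone ρ
  eq_one : ∀ x, m ≤ x → ρ x = 1
  eq_zero : ∀ x, x ≤ -m → ρ x = 0

/-- The univariate density `Ψ_ρ(x) = ρ(x + 1) - ρ(x - 1)`. -/
noncomputable def density (ρ : ℝ → ℝ) (x : ℝ) : ℝ := ρ (x + 1) - ρ (x - 1)

/-- The multivariate density `Ψ_ρ(x) = Ψ_ρ(x_1) ⋯ Ψ_ρ(x_r)`. -/
noncomputable def multiDensity (ρ : ℝ → ℝ) {r : ℕ} (x : Fin r → ℝ) : ℝ :=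
  ∏ j, density ρ (x j)

/-- The multi-indices `k ∈ ℤ^r` with `-n ≤ k_j ≤ n - 1` for all `j`. -/
noncomputable def gridIndex (r n : ℕ) : Finset (Fin r → ℤ) :=
  Fintype.piFinset fun _ => Finset.Icc (-(n : ℤ)) ((n : ℤ) - 1)

/-- The cell `I_{k,n} = ∏_j [k_j / n, (k_j + 1) / n]`. -/
def cell {r : ℕ} (n : ℕ) (k : Fin r → ℤ) : Set (Fin r → ℝ) :=
  Set.Icc (fun j => (k j : ℝ) / n) (fun j => ((k j : ℝ) + 1) / n)

/-- The multivariate Kantorovich-type neural network operator `K_n`. The quotient is read as `0`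
at the points where its denominator vanishes. -/
noncomputable def kantorovich (ρ : ℝ → ℝ) {r : ℕ} (n : ℕ) (f : (Fin r → ℝ) → ℝ)
    (x : Fin r → ℝ) : ℝ :=
  (∑ k ∈ gridIndex r n,
      ((n : ℝ) ^ r * ∫ t in cell n k, f t) * multiDensity ρ (fun j => n * x j - k j)) /
    ∑ k ∈ gridIndex r n, multiDensity ρ (fun j => n * x j - k j)

/-- The iterated norm over `[-1,1]^r` of a nonnegative function: first the `L^{p_1}` norm in
`x_1` (for fixed `x_2, …, x_r`), then the `L^{p_2}` norm in `x_2`, and so on, the outermost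
being the `L^{p_r}` norm in `x_r`. -/
noncomputable def mixedNormAux : {r : ℕ} → (Fin r → ℝ) → ((Fin r → ℝ) → ℝ≥0∞) → ℝ≥0∞
  | 0, _, F => F ![]
  | _ + 1, p, F =>
      mixedNormAux (fun i => p i.succ) fun y =>
        (∫⁻ t in Set.Icc (-1 : ℝ) 1, F (Fin.cons t y) ^ p 0) ^ (1 / p 0)

/-- The mixed norm `‖f‖_{(p_1, …, p_r)}` over `[-1,1]^r`, with values in `[0, ∞]`. -/
noncomputable def mixedNorm {r : ℕ} (p : Fin r → ℝ) (f : (Fin r → ℝ) → ℝ) : ℝ≥0∞ :=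
  mixedNormAux p fun x => ‖f x‖ₑ

/-- `f` belongs to the mixed-norm space `L^{(p_1, …, p_r)}([-1,1]^r)`: it is Lebesgue measurable
on the cube and its mixed norm is finite. Only the values of `f` on the cube matter. -/
def MemMixedLp {r : ℕ} (p : Fin r → ℝ) (f : (Fin r → ℝ) → ℝ) : Prop :=
  AEMeasurable f (volume.restrict (cube r)) ∧ mixedNorm p f < ∞

end KantorovichNN

namespace KantorovichNN

/-! The normalised weights are at most 1, and only cells within sup-distance `(m + 2) / n` of `x`
carry weight. Hence, for `n > 0`, `|K_n f(x)|` is at most `n ^ r` times the integral of `|f|` over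
that ball, a fixed constant `(2 * (m + 2)) ^ r` times an average (`enorm_kantorovich_le`). This
bound is used twice. Since the average is a superposition of translates, Minkowski's integral
inequality for the mixed norm makes the `K_n` uniformly bounded (`mixedNorm_kantorovich_le`). Since
`K_n` reproduces constants wherever its denominator is nonzero, applying the bound to `f - f x`
gives a.e. convergence at Lebesgue points (`ae_tendsto_kantorovich`). For bounded `f`, dominated
convergence in the mixed norm finishes. The general case follows by truncating `f` and absorbing the
error with the uniform bound. -/

/-! ### Slicing the cube; monotonicity of the mixed norm. -/

lemma measurableSet_cube (r : ℕ) : MeasurableSet (cube r) := measurableSet_Icc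

lemma cons_mem_cube {r : ℕ} (t : ℝ) (y : Fin r → ℝ) :
    (Fin.cons t y : Fin (r + 1) → ℝ) ∈ cube (r + 1) ↔ t ∈ Set.Icc (-1 : ℝ) 1 ∧ y ∈ cube r := by
  simp only [cube, Set.mem_Icc, Pi.le_def, Fin.forall_fin_succ, Fin.cons_zero, Fin.cons_succ]
  tauto

lemma measurable_cons (r : ℕ) :
    Measurable fun q : (Fin r → ℝ) × ℝ => (Fin.cons q.2 q.1 : Fin (r + 1) → ℝ) := by
  refine measurable_pi_lambda _ fun i => ?_
  refine Fin.cases ?_ (fun j => ?_) i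
  · simpa using measurable_snd
  · simpa using! (measurable_pi_apply j).comp measurable_fst

/-- The first coordinate is the second factor, so Tonelli integrates it innermost, matching the
recursion of `mixedNormAux`. -/
lemma measurePreserving_cons (r : ℕ) :
    MeasurePreserving (fun q : (Fin r → ℝ) × ℝ => (Fin.cons q.2 q.1 : Fin (r + 1) → ℝ))
      ((volume.restrict (cube r)).prod (volume.restrict (Set.Icc (-1 : ℝ) 1)))
      (volume.restrict (cube (r + 1))) := by
  have h := ((volume_preserving_piFinSuccAbove (fun _ : Fin (r + 1) => ℝ) 0).symm _).comp
    (Measure.measurePreserving_swap (μ := (volume : Measure (Fin r → ℝ)))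
      (ν := (volume : Measure ℝ)))
  have h' : MeasurePreserving (fun q : (Fin r → ℝ) × ℝ => (Fin.cons q.2 q.1 : Fin (r + 1) → ℝ))
      ((volume : Measure (Fin r → ℝ)).prod volume) volume := by
    have e : (fun q : (Fin r → ℝ) × ℝ => (Fin.cons q.2 q.1 : Fin (r + 1) → ℝ)) =
        (MeasurableEquiv.piFinSuccAbove (fun _ : Fin (r + 1) => ℝ) 0).symm ∘ Prod.swap :=
      funext fun q => (Fin.insertNth_zero' q.2 q.1).symm
    rw [e]
    exact h
  have h2 := h'.restrict_preimage (measurableSet_cube (r + 1))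
  convert h2 using 1
  rw [Measure.prod_restrict]
  congr 1
  ext q
  simp [cons_mem_cube, and_comm]

lemma ae_cons_of_ae {r : ℕ} {P : (Fin (r + 1) → ℝ) → Prop}
    (h : ∀ᵐ x ∂volume.restrict (cube (r + 1)), P x) :
    ∀ᵐ y ∂volume.restrict (cube r), ∀ᵐ t ∂volume.restrict (Set.Icc (-1 : ℝ) 1),
      P (Fin.cons t y) :=
  Measure.ae_ae_of_ae_prod ((measurePreserving_cons r).quasiMeasurePreserving.ae h)

/-- For `r = 0` the space is a single point of positive mass. This is the base case of inductions
with a.e. hypotheses. -/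
lemma eq_of_ae_zero {P : (Fin 0 → ℝ) → Prop}
    (h : ∀ᵐ x ∂volume.restrict (cube 0), P x) (y : Fin 0 → ℝ) : P y := by
  have : NeBot (ae (volume.restrict (cube 0))) := by
    rw [ae_neBot]
    have : cube 0 = Set.univ := Set.eq_univ_of_forall fun x => by simp [cube]
    rw [this, Measure.restrict_univ]
    exact NeZero.ne _
  obtain ⟨x, hx⟩ := h.exists
  rwa [Subsingleton.elim y x]

lemma mixedNormAux_mono_ae : ∀ {r : ℕ} {p : Fin r → ℝ}, (∀ i, 1 ≤ p i) →
    ∀ {F G : (Fin r → ℝ) → ℝ≥0∞}, (∀ᵐ x ∂volume.restrict (cube r), F x ≤ G x) →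
    mixedNormAux p F ≤ mixedNormAux p G
  | 0, _, _, _, _, h => eq_of_ae_zero h _
  | r + 1, p, hp, F, G, h => by
    have h0 : 0 ≤ p 0 := zero_le_one.trans (hp 0)
    refine mixedNormAux_mono_ae (fun i => hp i.succ) ?_
    filter_upwards [ae_cons_of_ae h] with y hy
    refine ENNReal.rpow_le_rpow (lintegral_mono_ae ?_) (by positivity)
    filter_upwards [hy] with t ht
    exact ENNReal.rpow_le_rpow ht h0

lemma mixedNormAux_congr_ae {r : ℕ} {p : Fin r → ℝ} (hp : ∀ i, 1 ≤ p i)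
    {F G : (Fin r → ℝ) → ℝ≥0∞} (h : ∀ᵐ x ∂volume.restrict (cube r), F x = G x) :
    mixedNormAux p F = mixedNormAux p G :=
  le_antisymm (mixedNormAux_mono_ae hp (h.mono fun _ hx => hx.le))
    (mixedNormAux_mono_ae hp (h.mono fun _ hx => hx.ge))

lemma mixedNormAux_mono {r : ℕ} {p : Fin r → ℝ} (hp : ∀ i, 1 ≤ p i)
    {F G : (Fin r → ℝ) → ℝ≥0∞} (h : ∀ x, F x ≤ G x) : mixedNormAux p F ≤ mixedNormAux p G :=
  mixedNormAux_mono_ae hp (ae_of_all _ h)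

/-! ### Minkowski's integral inequality. -/

/-- The parameter `s` is kept because the induction for Minkowski's inequality needs joint
measurability after each coordinate is integrated out. -/
lemma measurable_innerNorm {S : Type*} [MeasurableSpace S] {r : ℕ} (q : ℝ)
    {F : S → (Fin (r + 1) → ℝ) → ℝ≥0∞} (hF : Measurable (Function.uncurry F)) :
    Measurable (Function.uncurry fun s y =>
      (∫⁻ t in Set.Icc (-1 : ℝ) 1, F s (Fin.cons t y) ^ q) ^ (1 / q)) := by
  refine Measurable.pow_const ?_ _
  have : Measurable fun z : (S × (Fin r → ℝ)) × ℝ =>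
      F z.1.1 (Fin.cons z.2 z.1.2 : Fin (r + 1) → ℝ) ^ q := by
    refine Measurable.pow_const (?_ : Measurable fun z : (S × (Fin r → ℝ)) × ℝ =>
      F z.1.1 (Fin.cons z.2 z.1.2)) _
    exact hF.comp <| measurable_fst.fst.prodMk ((measurable_cons r).comp
      (measurable_fst.snd.prodMk measurable_snd))
  exact this.lintegral_prod_right

lemma measurable_innerNorm' {r : ℕ} (q : ℝ)
    {F : (Fin (r + 1) → ℝ) → ℝ≥0∞} (hF : Measurable F) :
    Measurable fun y : Fin r → ℝ =>
      (∫⁻ t in Set.Icc (-1 : ℝ) 1, F (Fin.cons t y) ^ q) ^ (1 / q) :=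
  (measurable_innerNorm (S := Unit) (F := fun _ => F) q (hF.comp measurable_snd)).comp
    (measurable_const.prodMk measurable_id : Measurable fun y : Fin r → ℝ => (((), y)))

/-- **Minkowski's integral inequality** for finite measures and bounded functions. -/
lemma lintegral_rpow_lintegral_le_of_bounded {S T : Type*} [MeasurableSpace S]
    [MeasurableSpace T] {μ : Measure T} {ν : Measure S} [IsFiniteMeasure μ] [IsFiniteMeasure ν]
    {q : ℝ} (hq : 1 ≤ q) {F : S → T → ℝ≥0∞} (hF : Measurable (Function.uncurry F))
    {N : ℝ≥0∞} (hN : N ≠ ∞) (hFN : ∀ s t, F s t ≤ N) :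
    (∫⁻ t, (∫⁻ s, F s t ∂ν) ^ q ∂μ) ^ (1 / q) ≤ ∫⁻ s, (∫⁻ t, F s t ^ q ∂μ) ^ (1 / q) ∂ν := by
  rcases hq.eq_or_lt with rfl | hq1
  · simp only [ENNReal.rpow_one, div_one]
    exact (lintegral_lintegral_swap hF.aemeasurable).ge
  have hq0 : 0 < q := zero_lt_one.trans hq1
  set H : T → ℝ≥0∞ := fun t => ∫⁻ s, F s t ∂ν with hH
  have hFs : Measurable fun z : T × S => F z.2 z.1 := hF.comp measurable_swap
  have hHm : Measurable H := hFs.lintegral_prod_right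
  set A := ∫⁻ t, H t ^ q ∂μ with hA
  have hconj : q.HolderConjugate q.conjExponent := Real.HolderConjugate.conjExponent hq1
  have hHN : ∀ t, H t ≤ N * ν Set.univ := fun t =>
    (lintegral_mono fun s => hFN s t).trans (by simp)
  -- Boundedness and finite measures are needed here: finiteness of `A` permits the final
  -- cancellation of `A ^ (1 / q.conjExponent)`.
  have hAtop : A ≠ ∞ := by
    have : A ≤ (N * ν Set.univ) ^ q * μ Set.univ :=
      (lintegral_mono fun t => ENNReal.rpow_le_rpow (hHN t) hq0.le).trans (by simp)
    refine ne_top_of_le_ne_top ?_ this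
    finiteness
  by_cases hA0 : A = 0
  · rw [hA0, ENNReal.zero_rpow_of_pos (by positivity)]
    exact zero_le
  have hexp : (q - 1) * q.conjExponent = q := hconj.sub_one_mul_conj
  -- Write `H ^ q = H * H ^ (q - 1)`, expand one factor `H`, swap the integrals, and apply Hölder in
  -- `t` for each `s`.
  have key : A ≤ (∫⁻ s, (∫⁻ t, F s t ^ q ∂μ) ^ (1 / q) ∂ν) * A ^ (1 / q.conjExponent) := by
    calc A = ∫⁻ t, ∫⁻ s, F s t * H t ^ (q - 1) ∂ν ∂μ := by
          refine lintegral_congr fun t => ?_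
          have hm : Measurable fun s => F s t := hFs.comp measurable_prodMk_left
          rw [lintegral_mul_const _ hm]
          change H t ^ q = H t * H t ^ (q - 1)
          conv_rhs => rw [← ENNReal.rpow_one (H t)]
          rw [← ENNReal.rpow_mul, one_mul,
            ← ENNReal.rpow_add_of_nonneg _ _ zero_le_one (by linarith)]
          ring_nf
      _ = ∫⁻ s, ∫⁻ t, F s t * H t ^ (q - 1) ∂μ ∂ν := by
          refine lintegral_lintegral_swap (Measurable.aemeasurable ?_)
          exact hFs.mul ((hHm.comp measurable_fst).pow_const _)
      _ ≤ ∫⁻ s, (∫⁻ t, F s t ^ q ∂μ) ^ (1 / q) * A ^ (1 / q.conjExponent) ∂ν := by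
          refine lintegral_mono fun s => ?_
          refine (ENNReal.lintegral_mul_le_Lp_mul_Lq μ hconj
            (hF.comp measurable_prodMk_left).aemeasurable
            (hHm.pow_const (q - 1)).aemeasurable).trans_eq ?_
          congr 2
          refine lintegral_congr fun t => ?_
          rw [← ENNReal.rpow_mul, hexp]
      _ = _ := by
          refine lintegral_mul_const _ ?_
          refine Measurable.pow_const ?_ _
          exact (hF.pow_const q).lintegral_prod_right'
  have hsplit : A = A ^ (1 / q) * A ^ (1 / q.conjExponent) := by
    rw [← ENNReal.rpow_add _ _ hA0 hAtop, one_div, one_div, hconj.inv_add_inv_eq_one,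
      ENNReal.rpow_one]
  have hne0 : A ^ (1 / q.conjExponent) ≠ 0 := by
    simp [ENNReal.rpow_eq_zero_iff, hA0, hAtop]
  have hnet : A ^ (1 / q.conjExponent) ≠ ∞ :=
    ENNReal.rpow_ne_top_of_nonneg (by simpa using hconj.symm.nonneg) hAtop
  exact (ENNReal.mul_le_mul_iff_left hne0 hnet).1 (hsplit.symm.trans_le key)

/-- **Minkowski's integral inequality** for finite measures. -/
lemma lintegral_rpow_lintegral_le {S T : Type*} [MeasurableSpace S]
    [MeasurableSpace T] {μ : Measure T} {ν : Measure S} [IsFiniteMeasure μ] [IsFiniteMeasure ν]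
    {q : ℝ} (hq : 1 ≤ q) {F : S → T → ℝ≥0∞} (hF : Measurable (Function.uncurry F)) :
    (∫⁻ t, (∫⁻ s, F s t ∂ν) ^ q ∂μ) ^ (1 / q) ≤ ∫⁻ s, (∫⁻ t, F s t ^ q ∂μ) ^ (1 / q) ∂ν := by
  have hq0 : 0 < q := zero_lt_one.trans_le hq
  have hFs : Measurable fun z : T × S => F z.2 z.1 := hF.comp measurable_swap
  -- Truncate `F` at height `N` and recover the general case by monotone convergence.
  have hmin : ∀ x : ℝ≥0∞, (⨆ N : ℕ, min x N) = x := fun x => by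
    rw [← inf_iSup_eq, ENNReal.iSup_natCast, inf_top_eq]
  have hmono : ∀ x : ℝ≥0∞, Monotone fun N : ℕ => min x (N : ℝ≥0∞) := fun x a b hab =>
    min_le_min le_rfl (by exact_mod_cast hab)
  have hpow : ∀ (e : ℝ), 0 < e → ∀ a : ℕ → ℝ≥0∞, (⨆ N, a N) ^ e = ⨆ N, a N ^ e :=
    fun e he a => (ENNReal.orderIsoRpow e he).map_iSup a
  have h1 : ∀ t, ∫⁻ s, F s t ∂ν = ⨆ N : ℕ, ∫⁻ s, min (F s t) N ∂ν := fun t => by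
    have hm : Measurable fun s => F s t := hFs.comp measurable_prodMk_left
    rw [← lintegral_iSup (fun N => hm.min measurable_const) (fun a b hab s => hmono _ hab)]
    simp only [hmin]
  have h2 : (∫⁻ t, (∫⁻ s, F s t ∂ν) ^ q ∂μ) ^ (1 / q)
      = ⨆ N : ℕ, (∫⁻ t, (∫⁻ s, min (F s t) N ∂ν) ^ q ∂μ) ^ (1 / q) := by
    rw [← hpow _ (by positivity), ← lintegral_iSup]
    · simp_rw [h1, hpow q hq0]
    · intro N
      refine Measurable.pow_const ?_ _
      exact (hFs.min measurable_const).lintegral_prod_right'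
    · intro a b hab t
      exact ENNReal.rpow_le_rpow (lintegral_mono fun s => hmono _ hab) hq0.le
  rw [h2]
  refine iSup_le fun N => ?_
  refine (lintegral_rpow_lintegral_le_of_bounded hq (hF.min measurable_const)
    (ENNReal.natCast_ne_top N) fun s t => min_le_right _ _).trans ?_
  refine lintegral_mono fun s => ENNReal.rpow_le_rpow (lintegral_mono fun t =>
    ENNReal.rpow_le_rpow (min_le_left _ _) hq0.le) (by positivity)

/-- Minkowski's integral inequality for the mixed norm. -/
lemma mixedNormAux_lintegral_le {S : Type*} [MeasurableSpace S] {ν : Measure S}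
    [IsFiniteMeasure ν] : ∀ {r : ℕ} {p : Fin r → ℝ}, (∀ i, 1 ≤ p i) →
    ∀ {F : S → (Fin r → ℝ) → ℝ≥0∞}, Measurable (Function.uncurry F) →
    mixedNormAux p (fun x => ∫⁻ s, F s x ∂ν) ≤ ∫⁻ s, mixedNormAux p (F s) ∂ν
  | 0, _, _, _, _ => le_rfl
  | r + 1, p, hp, F, hF => by
    refine (mixedNormAux_mono (fun i => hp i.succ) fun y => ?_).trans
      (mixedNormAux_lintegral_le (fun i => hp i.succ) (measurable_innerNorm (p 0) hF))
    refine lintegral_rpow_lintegral_le (F := fun s t => F s (Fin.cons t y)) (hp 0) ?_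
    exact hF.comp (measurable_fst.prodMk ((measurable_cons r).comp
      (measurable_const.prodMk measurable_snd)))

/-- A sum of two functions is an integral over `Bool` with counting measure. -/
lemma mixedNormAux_add_le {r : ℕ} {p : Fin r → ℝ} (hp : ∀ i, 1 ≤ p i)
    {F G : (Fin r → ℝ) → ℝ≥0∞} (hF : Measurable F) (hG : Measurable G) :
    mixedNormAux p (fun x => F x + G x) ≤ mixedNormAux p F + mixedNormAux p G := by
  have h := mixedNormAux_lintegral_le (ν := (Measure.count : Measure Bool)) hp
    (F := fun b x => bif b then F x else G x) (measurable_from_prod_countable_right fun b => by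
      cases b
      · exact hG
      · exact hF)
  simpa [lintegral_count, tsum_fintype] using h

/-! ### Translations, comparison with `L^1`, dominated convergence. -/

/-- Enlarge the inner integral to the whole line, translate, and return to `[-1, 1]` because `G`
vanishes outside the cube. The inner norm again vanishes outside the smaller cube, so induction
applies. -/
lemma mixedNormAux_translate_le : ∀ {r : ℕ} {p : Fin r → ℝ}, (∀ i, 1 ≤ p i) →
    ∀ {G : (Fin r → ℝ) → ℝ≥0∞}, (∀ x ∉ cube r, G x = 0) → ∀ s : Fin r → ℝ,
    mixedNormAux p (fun x => G (x + s)) ≤ mixedNormAux p G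
  | 0, _, _, G, _, s => le_of_eq (congrArg G (Subsingleton.elim _ _))
  | r + 1, p, hp, G, hG, s => by
    have h0 : 0 < p 0 := zero_lt_one.trans_le (hp 0)
    refine (mixedNormAux_mono (fun i => hp i.succ) fun y => ?_).trans
      (mixedNormAux_translate_le (fun i => hp i.succ)
        (G := fun y => (∫⁻ t in Set.Icc (-1 : ℝ) 1, G (Fin.cons t y) ^ p 0) ^ (1 / p 0))
        (fun y hy => ?_) (Fin.tail s))
    · refine ENNReal.rpow_le_rpow ?_ (by positivity)
      calc ∫⁻ t in Set.Icc (-1 : ℝ) 1, G ((Fin.cons t y : Fin (r + 1) → ℝ) + s) ^ p 0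
          ≤ ∫⁻ t : ℝ, G (Fin.cons (t + s 0) (y + Fin.tail s)) ^ p 0 := by
            refine (setLIntegral_le_lintegral _ _).trans_eq (lintegral_congr fun t => ?_)
            congr 2
            ext i
            refine Fin.cases ?_ (fun j => ?_) i <;> simp [Fin.tail]
        _ = ∫⁻ t : ℝ, G (Fin.cons t (y + Fin.tail s)) ^ p 0 :=
            lintegral_add_right_eq_self (fun t => G (Fin.cons t (y + Fin.tail s)) ^ p 0) (s 0)
        _ = ∫⁻ t in Set.Icc (-1 : ℝ) 1, G (Fin.cons t (y + Fin.tail s)) ^ p 0 := by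
            refine (setLIntegral_eq_of_support_subset ?_).symm
            intro t ht
            by_contra hc
            refine ht ?_
            change G _ ^ p 0 = 0
            rw [hG _ fun h => hc ((cons_mem_cube _ _).1 h).1, ENNReal.zero_rpow_of_pos h0]
    · have : ∀ t : ℝ, G (Fin.cons t y) ^ p 0 = 0 := fun t => by
        rw [hG _ fun h => hy ((cons_mem_cube _ _).1 h).2, ENNReal.zero_rpow_of_pos h0]
      simp only [this, lintegral_zero]
      exact ENNReal.zero_rpow_of_pos (by positivity)

/-- Hölder on an interval of length 2; the exact constant `2 ^ (1 - 1 / q)` is rounded up to 2. -/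
lemma lintegral_Icc_le {q : ℝ} (hq : 1 ≤ q) {g : ℝ → ℝ≥0∞} (hg : Measurable g) :
    ∫⁻ t in Set.Icc (-1 : ℝ) 1, g t ≤ 2 * (∫⁻ t in Set.Icc (-1 : ℝ) 1, g t ^ q) ^ (1 / q) := by
  have hq0 : 0 < q := zero_lt_one.trans_le hq
  have h := eLpNorm'_le_eLpNorm'_mul_rpow_measure_univ (f := g)
    (μ := volume.restrict (Set.Icc (-1 : ℝ) 1)) zero_lt_one hq hg.aestronglyMeasurable
  simp only [eLpNorm', enorm_eq_self, ENNReal.rpow_one, div_one, Measure.restrict_apply_univ,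
    Real.volume_Icc] at h
  rw [mul_comm]
  refine h.trans (mul_le_mul_right ?_ _)
  norm_num
  have : (2 : ℝ≥0∞) ^ (1 - q⁻¹) ≤ 2 ^ (1 : ℝ) :=
    ENNReal.rpow_le_rpow_of_exponent_le (by norm_num) (by simp [hq0.le])
  simpa using this

lemma lintegral_cube_le : ∀ {r : ℕ} {p : Fin r → ℝ}, (∀ i, 1 ≤ p i) →
    ∀ {F : (Fin r → ℝ) → ℝ≥0∞}, Measurable F →
    ∫⁻ x in cube r, F x ≤ 2 ^ r * mixedNormAux p F
  | 0, _, _, F, _ => by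
    have : cube 0 = Set.univ := Set.eq_univ_of_forall fun x => by simp [cube]
    rw [this, Measure.restrict_univ]
    have h2 : F = fun _ => F ![] := funext fun x => congrArg F (Subsingleton.elim _ _)
    rw [h2]
    simp [mixedNormAux, volume_pi]
  | r + 1, p, hp, F, hF => by
    have hm : Measurable fun z : (Fin r → ℝ) × ℝ => F (Fin.cons z.2 z.1) :=
      hF.comp (measurable_cons r)
    rw [← (measurePreserving_cons r).lintegral_comp hF, lintegral_prod _ hm.aemeasurable]
    calc ∫⁻ y in cube r, ∫⁻ t in Set.Icc (-1 : ℝ) 1, F (Fin.cons t y)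
        ≤ ∫⁻ y in cube r, 2 * (∫⁻ t in Set.Icc (-1 : ℝ) 1, F (Fin.cons t y) ^ p 0) ^ (1 / p 0) :=
          lintegral_mono fun y => lintegral_Icc_le (hp 0)
            (hF.comp ((measurable_cons r).comp (measurable_const.prodMk measurable_id)))
      _ = 2 * ∫⁻ y in cube r, (∫⁻ t in Set.Icc (-1 : ℝ) 1, F (Fin.cons t y) ^ p 0) ^ (1 / p 0) :=
          lintegral_const_mul _ (measurable_innerNorm' _ hF)
      _ ≤ 2 * (2 ^ r * mixedNormAux (fun i => p i.succ) _) := by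
          gcongr
          exact lintegral_cube_le (fun i => hp i.succ) (measurable_innerNorm' _ hF)
      _ = 2 ^ (r + 1) * mixedNormAux p F := by
          rw [← mul_assoc, pow_succ']
          rfl

lemma ae_lt_top_of_mixedNormAux {r : ℕ} {p : Fin r → ℝ} (hp : ∀ i, 1 ≤ p i)
    {F : (Fin r → ℝ) → ℝ≥0∞} (hF : Measurable F) (h : mixedNormAux p F < ∞) :
    ∀ᵐ x ∂volume.restrict (cube r), F x < ∞ := by
  refine ae_lt_top hF (ne_top_of_le_ne_top ?_ (lintegral_cube_le hp hF))
  exact ENNReal.mul_ne_top (by finiteness) h.ne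

lemma mixedNormAux_const_lt_top : ∀ {r : ℕ} {p : Fin r → ℝ}, (∀ i, 1 ≤ p i) →
    ∀ {c : ℝ≥0∞}, c < ∞ → mixedNormAux p (fun _ => c) < ∞
  | 0, _, _, _, hc => hc
  | r + 1, p, hp, c, hc => by
    have h0 : 0 < p 0 := zero_lt_one.trans_le (hp 0)
    refine mixedNormAux_const_lt_top (fun i => hp i.succ) ?_
    refine ENNReal.rpow_lt_top_of_nonneg (by positivity) ?_
    rw [setLIntegral_const]
    refine ENNReal.mul_ne_top (ENNReal.rpow_ne_top_of_nonneg h0.le hc.ne) (by simp)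

/-- Dominated convergence for the mixed norm. -/
lemma tendsto_mixedNormAux_of_dominated : ∀ {r : ℕ} {p : Fin r → ℝ}, (∀ i, 1 ≤ p i) →
    ∀ {F : ℕ → (Fin r → ℝ) → ℝ≥0∞} {G : (Fin r → ℝ) → ℝ≥0∞}, (∀ n, Measurable (F n)) →
    Measurable G → mixedNormAux p G < ∞ →
    (∀ n, ∀ᵐ x ∂volume.restrict (cube r), F n x ≤ G x) →
    (∀ᵐ x ∂volume.restrict (cube r), Tendsto (fun n => F n x) atTop (𝓝 0)) →
    Tendsto (fun n => mixedNormAux p (F n)) atTop (𝓝 0)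
  | 0, _, _, _, _, _, _, _, _, h => eq_of_ae_zero h _
  | r + 1, p, hp, F, G, hF, hG, hGt, hFG, h => by
    have h0 : 0 < p 0 := zero_lt_one.trans_le (hp 0)
    have hs : ∀ (H : (Fin (r + 1) → ℝ) → ℝ≥0∞), Measurable H → ∀ y : Fin r → ℝ,
        Measurable fun t : ℝ => H (Fin.cons t y) ^ p 0 := fun H hH y =>
      (hH.comp ((measurable_cons r).comp (measurable_const.prodMk measurable_id))).pow_const _
    refine tendsto_mixedNormAux_of_dominated (fun i => hp i.succ)
      (G := fun y => (∫⁻ t in Set.Icc (-1 : ℝ) 1, G (Fin.cons t y) ^ p 0) ^ (1 / p 0))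
      (fun n => measurable_innerNorm' _ (hF n)) (measurable_innerNorm' _ hG) hGt
      (fun n => ?_) ?_
    · filter_upwards [ae_cons_of_ae (hFG n)] with y hy
      refine ENNReal.rpow_le_rpow (lintegral_mono_ae ?_) (by positivity)
      filter_upwards [hy] with t ht
      exact ENNReal.rpow_le_rpow ht h0.le
    -- Almost every fibre has a finite inner norm of `G`, so ordinary dominated convergence applies
    -- there; the outer coordinates are handled by induction.
    · filter_upwards [ae_cons_of_ae h, ae_cons_of_ae (ae_all_iff.2 hFG),
        ae_lt_top_of_mixedNormAux (fun i => hp i.succ) (measurable_innerNorm' _ hG) hGt]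
        with y hy1 hy2 hy3
      have hz : (0 : ℝ≥0∞) = 0 ^ (1 / p 0) := (ENNReal.zero_rpow_of_pos (by positivity)).symm
      rw [hz]
      refine (ENNReal.continuous_rpow_const.tendsto _).comp ?_
      have hlim := tendsto_lintegral_of_dominated_convergence
        (μ := volume.restrict (Set.Icc (-1 : ℝ) 1)) (f := fun _ => 0)
        (F := fun n t => F n (Fin.cons t y) ^ p 0)
        (fun t => G (Fin.cons t y) ^ p 0) (fun n => hs _ (hF n) y) (fun n => ?_) ?_ ?_
      · simpa using hlim
      · filter_upwards [hy2] with t ht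
        exact ENNReal.rpow_le_rpow (ht n) h0.le
      · intro htop
        rw [htop, ENNReal.top_rpow_of_pos (by positivity)] at hy3
        exact hy3.ne rfl
      · filter_upwards [hy1] with t ht
        have := (ENNReal.continuous_rpow_const (y := p 0)).tendsto 0 |>.comp ht
        rwa [ENNReal.zero_rpow_of_pos h0] at this

/-! ### Supports of the densities and geometry of the cells. -/

lemma SigmoidalClass.density_nonneg {m : ℝ} {ρ : ℝ → ℝ} (hρ : SigmoidalClass m ρ) (x : ℝ) :
    0 ≤ density ρ x :=
  sub_nonneg.2 (hρ.monotone (by linarith))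

lemma SigmoidalClass.abs_lt_of_density_ne_zero {m : ℝ} {ρ : ℝ → ℝ} (hρ : SigmoidalClass m ρ)
    {x : ℝ} (h : density ρ x ≠ 0) : |x| < m + 1 := by
  rw [abs_lt]
  constructor <;> by_contra! hx <;> refine h ?_ <;> rw [density]
  · rw [hρ.eq_zero _ (by linarith), hρ.eq_zero _ (by linarith), sub_zero]
  · rw [hρ.eq_one _ (by linarith), hρ.eq_one _ (by linarith), sub_self]

lemma SigmoidalClass.measurable_density {m : ℝ} {ρ : ℝ → ℝ} (hρ : SigmoidalClass m ρ) :
    Measurable (density ρ) :=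
  (hρ.measurable.comp (measurable_id.add_const 1)).sub
    (hρ.measurable.comp (measurable_id.sub_const 1))

lemma SigmoidalClass.multiDensity_nonneg {m : ℝ} {ρ : ℝ → ℝ} (hρ : SigmoidalClass m ρ) {r : ℕ}
    (x : Fin r → ℝ) : 0 ≤ multiDensity ρ x :=
  Finset.prod_nonneg fun _ _ => hρ.density_nonneg _

lemma SigmoidalClass.measurable_kantorovich {m : ℝ} {ρ : ℝ → ℝ} (hρ : SigmoidalClass m ρ)
    {r : ℕ} (n : ℕ) (f : (Fin r → ℝ) → ℝ) : Measurable (kantorovich ρ n f) := by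
  have hw : ∀ k : Fin r → ℤ, Measurable fun x : Fin r → ℝ =>
      multiDensity ρ (fun j => n * x j - k j) := fun k =>
    Finset.measurable_prod _ fun j _ => hρ.measurable_density.comp
      (((measurable_pi_apply j).const_mul _).sub_const _)
  exact (Finset.measurable_sum _ fun k _ => (hw k).const_mul _).div
    (Finset.measurable_sum _ fun k _ => hw k)

/-- In every coordinate some admissible node is active, away from the boundary of `[-1, 1]`. -/
lemma SigmoidalClass.exists_density_ne_zero {m : ℝ} {ρ : ℝ → ℝ} (hρ : SigmoidalClass m ρ)
    {n : ℕ} {u : ℝ} (h1 : m ≤ u + n + 1) (h2 : u - n + 1 ≤ -m) :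
    ∃ k ∈ Finset.Icc (-(n : ℤ)) ((n : ℤ) - 1), density ρ (u - k) ≠ 0 := by
  by_contra! h
  -- If the density vanished at every node, the nodes `-n + 2 * i` would give equal values of `ρ` in
  -- steps of 2 from `u + n + 1` down to `u - n + 1`, where `ρ` is 1 and 0 respectively.
  have key : ∀ i : ℕ, i ≤ n → ρ (u + n + 1 - 2 * i) = ρ (u + n + 1) := by
    intro i
    induction i with
    | zero => simp
    | succ i ih =>
      intro hi
      rw [← ih (by omega)]
      have := h (-(n : ℤ) + 2 * i) (Finset.mem_Icc.2 ⟨by omega, by omega⟩)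
      rw [density, sub_eq_zero] at this
      convert this.symm using 2 <;> push_cast <;> ring
  have h3 := key n le_rfl
  rw [hρ.eq_one _ h1, hρ.eq_zero _ (by linarith)] at h3
  exact zero_ne_one h3

lemma SigmoidalClass.sum_multiDensity_ne_zero {m : ℝ} {ρ : ℝ → ℝ} (hρ : SigmoidalClass m ρ)
    {r n : ℕ} {x : Fin r → ℝ} (h1 : ∀ j, m ≤ n * x j + n + 1)
    (h2 : ∀ j, n * x j - n + 1 ≤ -m) :
    ∑ k ∈ gridIndex r n, multiDensity ρ (fun j => n * x j - k j) ≠ 0 := by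
  choose k hk hk' using fun j => hρ.exists_density_ne_zero (h1 j) (h2 j)
  refine (Finset.sum_pos' (fun _ _ => hρ.multiDensity_nonneg _)
    ⟨k, Fintype.mem_piFinset.2 hk, ?_⟩).ne'
  exact (hρ.multiDensity_nonneg _).lt_of_ne' (Finset.prod_ne_zero_iff.2 fun j _ => hk' j)

lemma cell_subset_cube {r n : ℕ} (hn : 0 < n) {k : Fin r → ℤ} (hk : k ∈ gridIndex r n) :
    cell n k ⊆ cube r := by
  have hn' : (0 : ℝ) < n := by exact_mod_cast hn
  refine Set.Icc_subset_Icc (fun j => ?_) (fun j => ?_)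
  · have := (Finset.mem_Icc.1 (Fintype.mem_piFinset.1 hk j)).1
    have : (-(n : ℝ)) ≤ k j := by exact_mod_cast this
    change (-1 : ℝ) ≤ k j / n
    rw [le_div_iff₀ hn']
    linarith
  · have := (Finset.mem_Icc.1 (Fintype.mem_piFinset.1 hk j)).2
    have : (k j : ℝ) ≤ n - 1 := by exact_mod_cast this
    change ((k j : ℝ) + 1) / n ≤ 1
    rw [div_le_one hn']
    linarith

lemma volume_real_cell {r n : ℕ} (hn : 0 < n) (k : Fin r → ℤ) :
    volume.real (cell n k) = ((n : ℝ) ^ r)⁻¹ := by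
  have hn' : (0 : ℝ) < n := by exact_mod_cast hn
  rw [cell, Measure.real, Real.volume_Icc_pi_toReal]
  · have : ∀ j, ((k j : ℝ) + 1) / n - k j / n = (n : ℝ)⁻¹ := fun j => by
      field_simp
      ring
    simp [this]
  · intro j
    exact div_le_div_of_nonneg_right (by linarith) (by positivity)

lemma cell_ae_eq {r : ℕ} (n : ℕ) (k : Fin r → ℤ) :
    (Set.univ.pi fun j => Set.Ico ((k j : ℝ) / n) (((k j : ℝ) + 1) / n)) =ᵐ[volume] cell n k :=
  Measure.univ_pi_Ico_ae_eq_Icc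

lemma pairwise_disjoint_halfOpen_cell {r n : ℕ} (hn : 0 < n) :
    Pairwise fun k l : Fin r → ℤ => Disjoint
      (Set.univ.pi fun j => Set.Ico ((k j : ℝ) / n) (((k j : ℝ) + 1) / n))
      (Set.univ.pi fun j => Set.Ico ((l j : ℝ) / n) (((l j : ℝ) + 1) / n)) := by
  intro k l hkl
  have hn' : (0 : ℝ) < n := by exact_mod_cast hn
  rw [Set.disjoint_left]
  intro t hk hl
  have hfloor : ∀ (k : Fin r → ℤ), t ∈ (Set.univ.pi fun j =>
      Set.Ico ((k j : ℝ) / n) (((k j : ℝ) + 1) / n)) → ∀ j, ⌊t j * n⌋ = k j := fun k hk j => by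
    have := hk j trivial
    rw [Set.mem_Ico, div_le_iff₀ hn', lt_div_iff₀ hn'] at this
    exact Int.floor_eq_iff.2 this
  exact hkl (funext fun j => (hfloor k hk j).symm.trans (hfloor l hl j))

/-- In each coordinate `|n x - k| < m + 1` at an active node and `0 ≤ n t - k ≤ 1` in its cell,
whence the radius `(m + 2) / n`. -/
lemma SigmoidalClass.cell_subset_closedBall {m : ℝ} {ρ : ℝ → ℝ} (hρ : SigmoidalClass m ρ)
    (hm : 0 ≤ m) {r n : ℕ} (hn : 0 < n) {k : Fin r → ℤ} {x : Fin r → ℝ}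
    (h : multiDensity ρ (fun j => n * x j - k j) ≠ 0) :
    cell n k ⊆ Metric.closedBall x ((m + 2) / n) := by
  intro t ht
  have hn' : (0 : ℝ) < n := by exact_mod_cast hn
  rw [Metric.mem_closedBall, dist_pi_le_iff (by positivity)]
  intro j
  have hj := abs_lt.1 (hρ.abs_lt_of_density_ne_zero (Finset.prod_ne_zero_iff.1 h j (Finset.mem_univ j)))
  have h1 : (k j : ℝ) / n ≤ t j := ht.1 j
  have h2 : t j ≤ ((k j : ℝ) + 1) / n := ht.2 j
  rw [div_le_iff₀ hn'] at h1
  rw [le_div_iff₀ hn'] at h2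
  rw [Real.dist_eq, le_div_iff₀ hn']
  nth_rw 1 [← abs_of_pos hn']
  rw [← abs_mul, abs_le]
  constructor <;> linarith

/-! ### Domination by local averages and a.e. convergence. -/

/-- The operator is dominated by an average over a cube of side comparable to `1 / n`. -/
lemma SigmoidalClass.enorm_kantorovich_le {m : ℝ} {ρ : ℝ → ℝ} (hρ : SigmoidalClass m ρ)
    (hm : 0 ≤ m) {r n : ℕ} (hn : 0 < n) (f : (Fin r → ℝ) → ℝ) (x : Fin r → ℝ) :
    ‖kantorovich ρ n f x‖ₑ ≤
      (n : ℝ≥0∞) ^ r * ∫⁻ t in Metric.closedBall x ((m + 2) / n), ‖f t‖ₑ := by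
  classical
  set w : (Fin r → ℤ) → ℝ := fun k => multiDensity ρ (fun j => n * x j - k j) with hw
  have hw0 : ∀ k, 0 ≤ w k := fun k => hρ.multiDensity_nonneg _
  -- Half-open cells are genuinely disjoint, so the sum of integrals becomes one integral over a
  -- union.
  set U : (Fin r → ℤ) → Set (Fin r → ℝ) := fun k =>
    Set.univ.pi fun j => Set.Ico ((k j : ℝ) / n) (((k j : ℝ) + 1) / n) with hU
  have hUc : ∀ k, ∫⁻ t in cell n k, ‖f t‖ₑ = ∫⁻ t in U k, ‖f t‖ₑ := fun k =>
    (setLIntegral_congr (cell_ae_eq n k)).symm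
  calc ‖kantorovich ρ n f x‖ₑ
      = ‖∑ k ∈ gridIndex r n, ((n : ℝ) ^ r * ∫ t in cell n k, f t) *
          (w k / ∑ k ∈ gridIndex r n, w k)‖ₑ := by
        simp only [kantorovich, Finset.sum_div, mul_div_assoc, hw]
    _ ≤ ∑ k ∈ gridIndex r n, ‖((n : ℝ) ^ r * ∫ t in cell n k, f t) *
          (w k / ∑ k ∈ gridIndex r n, w k)‖ₑ := enorm_sum_le _ _
    _ ≤ ∑ k ∈ gridIndex r n, if w k ≠ 0 then (n : ℝ≥0∞) ^ r * ∫⁻ t in U k, ‖f t‖ₑ else 0 := by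
        refine Finset.sum_le_sum fun k hk => ?_
        split_ifs with h
        · rw [enorm_mul, enorm_mul, enorm_pow, Real.enorm_natCast]
          have h1 : ‖w k / ∑ k ∈ gridIndex r n, w k‖ₑ ≤ 1 := by
            rw [Real.enorm_of_nonneg (div_nonneg (hw0 k) (Finset.sum_nonneg fun k _ => hw0 k)),
              ENNReal.ofReal_le_one]
            exact div_le_one_of_le₀ (Finset.single_le_sum (fun k _ => hw0 k) hk)
              (Finset.sum_nonneg fun k _ => hw0 k)
          refine (mul_le_mul' le_rfl h1).trans ?_
          rw [mul_one, ← hUc]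
          gcongr
          exact enorm_integral_le_lintegral_enorm _
        · simp [not_not.1 h]
    _ = (n : ℝ≥0∞) ^ r * ∑ k ∈ gridIndex r n with w k ≠ 0, ∫⁻ t in U k, ‖f t‖ₑ := by
        rw [← Finset.sum_filter, Finset.mul_sum]
    _ = (n : ℝ≥0∞) ^ r *
          ∫⁻ t in ⋃ k ∈ (gridIndex r n).filter fun k => w k ≠ 0, U k, ‖f t‖ₑ := by
        rw [lintegral_biUnion_finset]
        · exact fun k _ l _ hkl => pairwise_disjoint_halfOpen_cell hn hkl
        · exact fun k _ => MeasurableSet.univ_pi fun j => measurableSet_Ico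
    _ ≤ _ := by
        gcongr
        refine Set.iUnion₂_subset fun k hk => ?_
        refine Set.Subset.trans ?_
          (hρ.cell_subset_closedBall hm hn (Finset.mem_filter.1 hk).2)
        exact (Set.pi_mono fun j _ => Set.Ico_subset_Icc_self).trans (Set.pi_univ_Icc _ _).subset

lemma kantorovich_sub (ρ : ℝ → ℝ) {r n : ℕ} {f g : (Fin r → ℝ) → ℝ}
    (hf : ∀ k ∈ gridIndex r n, IntegrableOn f (cell n k))
    (hg : ∀ k ∈ gridIndex r n, IntegrableOn g (cell n k)) (x : Fin r → ℝ) :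
    kantorovich ρ n (fun t => f t - g t) x = kantorovich ρ n f x - kantorovich ρ n g x := by
  simp only [kantorovich]
  rw [← sub_div, ← Finset.sum_sub_distrib]
  congr 1
  refine Finset.sum_congr rfl fun k hk => ?_
  rw [integral_sub (hf k hk) (hg k hk)]
  ring

lemma kantorovich_const {ρ : ℝ → ℝ} {r n : ℕ} (hn : 0 < n) (c : ℝ) {x : Fin r → ℝ}
    (h : ∑ k ∈ gridIndex r n, multiDensity ρ (fun j => n * x j - k j) ≠ 0) :
    kantorovich ρ n (fun _ => c) x = c := by
  have hn' : (n : ℝ) ^ r ≠ 0 := by positivity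
  simp only [kantorovich, setIntegral_const, volume_real_cell hn, smul_eq_mul,
    mul_inv_cancel_left₀ hn', ← Finset.mul_sum]
  exact mul_div_cancel_right₀ c h

lemma kantorovich_congr_ae (ρ : ℝ → ℝ) {r n : ℕ} (hn : 0 < n) {f g : (Fin r → ℝ) → ℝ}
    (h : f =ᵐ[volume.restrict (cube r)] g) : kantorovich ρ n f = kantorovich ρ n g := by
  funext x
  simp only [kantorovich]
  congr 1
  refine Finset.sum_congr rfl fun k hk => ?_
  rw [integral_congr_ae (ae_restrict_of_ae_restrict_of_subset (cell_subset_cube hn hk) h)]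

lemma integrableOn_const_cell {r : ℕ} (n : ℕ) (k : Fin r → ℤ) (c : ℝ) :
    IntegrableOn (fun _ => c) (cell n k) :=
  integrableOn_const isCompact_Icc.measure_ne_top

/-- Almost everywhere convergence on the cube. -/
lemma SigmoidalClass.ae_tendsto_kantorovich {m : ℝ} {ρ : ℝ → ℝ} (hρ : SigmoidalClass m ρ)
    (hm : 0 ≤ m) {r : ℕ} {f : (Fin r → ℝ) → ℝ} (hf : Integrable f) :
    ∀ᵐ x ∂volume.restrict (cube r), Tendsto (fun n : ℕ => kantorovich ρ n f x) atTop (𝓝 (f x)) := by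
  have hI : ∀ᵐ x ∂volume.restrict (cube r), ∀ j, x j ∈ Set.Ioo (-1 : ℝ) 1 := by
    have : (Set.univ.pi fun _ : Fin r => Set.Ioo (-1 : ℝ) 1) =ᵐ[volume] cube r :=
      Measure.univ_pi_Ioo_ae_eq_Icc
    rw [← Measure.restrict_congr_set this]
    filter_upwards [ae_restrict_mem (MeasurableSet.univ_pi fun _ => measurableSet_Ioo)]
      with x hx j using hx j trivial
  filter_upwards [hI, ae_restrict_of_ae (IsUnifLocDoublingMeasure.ae_tendsto_average_norm_sub
    (μ := volume) hf.locallyIntegrable 1)] with x hx hleb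
  have hδ : Tendsto (fun n : ℕ => (m + 2) / (n : ℝ)) atTop (𝓝[>] 0) := by
    refine tendsto_nhdsWithin_iff.2 ⟨tendsto_const_div_atTop_nhds_zero_nat _, ?_⟩
    filter_upwards [eventually_gt_atTop 0] with n hn
    have : (0 : ℝ) < n := by exact_mod_cast hn
    exact div_pos (by linarith) this
  have hlim := hleb (fun _ => x) _ hδ (by
    filter_upwards [eventually_gt_atTop 0] with n hn
    exact Metric.mem_closedBall_self (by positivity))
  -- Interior points eventually have a nonzero denominator; boundary points were discarded as a null
  -- set.
  have hbig : ∀ᶠ n : ℕ in atTop, ∀ j, m ≤ n * x j + n + 1 ∧ n * x j - n + 1 ≤ -m := by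
    refine eventually_all.2 fun j => ?_
    have h1 : Tendsto (fun n : ℕ => (n : ℝ) * (x j + 1)) atTop atTop :=
      tendsto_natCast_atTop_atTop.atTop_mul_const (by linarith [(hx j).1])
    have h2 : Tendsto (fun n : ℕ => (n : ℝ) * (1 - x j)) atTop atTop :=
      tendsto_natCast_atTop_atTop.atTop_mul_const (by linarith [(hx j).2])
    filter_upwards [h1.eventually_ge_atTop m, h2.eventually_ge_atTop (m + 1)] with n h1 h2
    constructor <;> linarith
  rw [tendsto_iff_norm_sub_tendsto_zero]
  have hlim' := hlim.const_mul ((2 * (m + 2)) ^ r)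
  rw [mul_zero] at hlim'
  refine squeeze_zero' (Eventually.of_forall fun _ => norm_nonneg _) ?_ hlim'
  filter_upwards [hbig, eventually_gt_atTop 0] with n hb hn
  have hn' : (0 : ℝ) < n := by exact_mod_cast hn
  have hD := hρ.sum_multiDensity_ne_zero (fun j => (hb j).1) (fun j => (hb j).2)
  have hball : IntegrableOn (fun t => ‖f t - f x‖) (Metric.closedBall x ((m + 2) / n)) :=
    (hf.integrableOn.sub (integrableOn_const measure_closedBall_lt_top.ne)).norm
  -- The first rewrite replaces every `f x`, also inside the average; the last one restores the
  -- latter. The left side becomes the operator applied to `f - f x`.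
  rw [← kantorovich_const hn (f x) hD, ← kantorovich_sub ρ (fun _ _ => hf.integrableOn)
    (fun k _ => integrableOn_const_cell n k (f x)), kantorovich_const hn (f x) hD]
  have h := hρ.enorm_kantorovich_le hm hn (fun t => f t - f x) x
  rw [setAverage_eq, Measure.real, Real.volume_pi_closedBall _ (by positivity),
    ENNReal.toReal_ofReal (by positivity), Fintype.card_fin, smul_eq_mul]
  have h0 : 0 ≤ ∫ t in Metric.closedBall x ((m + 2) / n), ‖f t - f x‖ :=
    integral_nonneg fun _ => norm_nonneg _
  have e : (2 * (m + 2)) ^ r * (((2 * ((m + 2) / n)) ^ r)⁻¹ *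
      ∫ t in Metric.closedBall x ((m + 2) / n), ‖f t - f x‖) =
      (n : ℝ) ^ r * ∫ t in Metric.closedBall x ((m + 2) / n), ‖f t - f x‖ := by
    rw [← mul_assoc]
    congr 1
    rw [← inv_pow, ← mul_pow]
    congr 1
    field_simp
  rw [e]
  have h2 : ∫⁻ t in Metric.closedBall x ((m + 2) / n), ‖f t - f x‖ₑ =
      ENNReal.ofReal (∫ t in Metric.closedBall x ((m + 2) / n), ‖f t - f x‖) := by
    rw [ofReal_integral_eq_lintegral_ofReal hball (ae_of_all _ fun _ => norm_nonneg _)]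
    simp only [ofReal_norm]
  rw [h2, ← ofReal_norm, ← ENNReal.ofReal_natCast, ← ENNReal.ofReal_pow hn'.le,
    ← ENNReal.ofReal_mul (by positivity)] at h
  exact (ENNReal.ofReal_le_ofReal_iff (by positivity)).1 h

lemma pow_mul_volume_closedBall {m : ℝ} (hm : 0 ≤ m) {r n : ℕ} (hn : 0 < n) (x : Fin r → ℝ) :
    (n : ℝ≥0∞) ^ r * volume (Metric.closedBall x ((m + 2) / n)) =
      ENNReal.ofReal ((2 * (m + 2)) ^ r) := by
  have hn' : (0 : ℝ) < n := by exact_mod_cast hn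
  rw [Real.volume_pi_closedBall _ (by positivity), Fintype.card_fin, ← ENNReal.ofReal_natCast,
    ← ENNReal.ofReal_pow hn'.le, ← ENNReal.ofReal_mul (by positivity), ← mul_pow]
  congr 2
  field_simp

lemma setLIntegral_closedBall_eq {r : ℕ} (G : (Fin r → ℝ) → ℝ≥0∞) (x : Fin r → ℝ) (δ : ℝ) :
    ∫⁻ t in Metric.closedBall x δ, G t = ∫⁻ s in Metric.closedBall 0 δ, G (x + s) := by
  rw [← lintegral_indicator Metric.isClosed_closedBall.measurableSet,
    ← lintegral_indicator Metric.isClosed_closedBall.measurableSet,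
    ← lintegral_add_left_eq_self _ x]
  refine lintegral_congr fun s => ?_
  simp [Set.indicator]

/-! ### Uniform boundedness, truncation and conclusion. -/

/-- The operators are uniformly bounded in the mixed norm. -/
lemma SigmoidalClass.mixedNorm_kantorovich_le {m : ℝ} {ρ : ℝ → ℝ} (hρ : SigmoidalClass m ρ)
    (hm : 0 ≤ m) {r n : ℕ} (hn : 0 < n) {p : Fin r → ℝ} (hp : ∀ i, 1 ≤ p i)
    {g : (Fin r → ℝ) → ℝ} (hg : Measurable g) (hg0 : ∀ x ∉ cube r, g x = 0) :
    mixedNorm p (kantorovich ρ n g) ≤ ENNReal.ofReal ((2 * (m + 2)) ^ r) * mixedNorm p g := by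
  -- With this measure the dominating average is `∫⁻ s, ‖g (x + s)‖ₑ ∂ν`, and its mass does not
  -- depend on `n`.
  set ν : Measure (Fin r → ℝ) :=
    ((n : ℝ≥0∞) ^ r) • volume.restrict (Metric.closedBall 0 ((m + 2) / n)) with hν
  have hν1 : ν Set.univ = ENNReal.ofReal ((2 * (m + 2)) ^ r) := by
    rw [hν, Measure.smul_apply, Measure.restrict_apply_univ, smul_eq_mul,
      pow_mul_volume_closedBall hm hn]
  have : IsFiniteMeasure ν := ⟨by rw [hν1]; exact ENNReal.ofReal_lt_top⟩
  have hF : Measurable (Function.uncurry fun s x : Fin r → ℝ => ‖g (x + s)‖ₑ) :=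
    (hg.comp (measurable_snd.add measurable_fst)).enorm
  calc mixedNorm p (kantorovich ρ n g)
      ≤ mixedNormAux p (fun x => ∫⁻ s, ‖g (x + s)‖ₑ ∂ν) := by
        refine mixedNormAux_mono hp fun x => ?_
        rw [hν, lintegral_smul_measure, smul_eq_mul,
          ← setLIntegral_closedBall_eq (fun t => ‖g t‖ₑ)]
        exact hρ.enorm_kantorovich_le hm hn g x
    _ ≤ ∫⁻ s, mixedNormAux p (fun x => ‖g (x + s)‖ₑ) ∂ν := mixedNormAux_lintegral_le hp hF
    _ ≤ ∫⁻ _, mixedNorm p g ∂ν := lintegral_mono fun s =>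
        mixedNormAux_translate_le hp (G := fun x => ‖g x‖ₑ) (fun x hx => by simp [hg0 x hx]) s
    _ = _ := by rw [lintegral_const, hν1, mul_comm]

lemma mixedNorm_add_le {r : ℕ} {p : Fin r → ℝ} (hp : ∀ i, 1 ≤ p i)
    {f g : (Fin r → ℝ) → ℝ} (hf : Measurable f) (hg : Measurable g) :
    mixedNorm p (fun x => f x + g x) ≤ mixedNorm p f + mixedNorm p g :=
  (mixedNormAux_mono hp fun _ => enorm_add_le _ _).trans
    (mixedNormAux_add_le hp hf.enorm hg.enorm)

lemma integrable_of_mixedNorm_lt_top {r : ℕ} {p : Fin r → ℝ} (hp : ∀ i, 1 ≤ p i)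
    {f : (Fin r → ℝ) → ℝ} (hf : Measurable f) (hf0 : ∀ x ∉ cube r, f x = 0)
    (h : mixedNorm p f < ∞) : Integrable f := by
  rw [← integrableOn_iff_integrable_of_support_subset (s := cube r)
    fun x hx => by_contra fun hc => hx (hf0 x hc)]
  refine ⟨hf.aestronglyMeasurable, ?_⟩
  exact (lintegral_cube_le hp hf.enorm).trans_lt
    (ENNReal.mul_lt_top (by finiteness) h)

/-- Convergence for bounded functions. -/
lemma SigmoidalClass.tendsto_of_bounded {m : ℝ} {ρ : ℝ → ℝ} (hρ : SigmoidalClass m ρ)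
    (hm : 0 ≤ m) {r : ℕ} {p : Fin r → ℝ} (hp : ∀ i, 1 ≤ p i)
    {f : (Fin r → ℝ) → ℝ} (hf : Measurable f) (hf0 : ∀ x ∉ cube r, f x = 0)
    {B : ℝ≥0∞} (hB : B < ∞) (hfB : ∀ x, ‖f x‖ₑ ≤ B) :
    Tendsto (fun n : ℕ => mixedNorm p (fun x => f x - kantorovich ρ n f x)) atTop (𝓝 0) := by
  -- The pointwise bound needs `n > 0`, while dominated convergence asks for domination at every
  -- index.
  rw [← tendsto_add_atTop_iff_nat 1]
  have hfi : Integrable f := integrable_of_mixedNorm_lt_top hp hf hf0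
    ((mixedNormAux_mono hp hfB).trans_lt (mixedNormAux_const_lt_top hp hB))
  refine tendsto_mixedNormAux_of_dominated hp
    (G := fun _ => B + ENNReal.ofReal ((2 * (m + 2)) ^ r) * B)
    (fun n => (hf.sub (hρ.measurable_kantorovich _ f)).enorm) measurable_const
    (mixedNormAux_const_lt_top hp (by finiteness)) (fun n => ae_of_all _ fun x => ?_) ?_
  · refine enorm_sub_le.trans (add_le_add (hfB x) ?_)
    refine (hρ.enorm_kantorovich_le hm n.succ_pos f x).trans ?_
    rw [← pow_mul_volume_closedBall hm n.succ_pos x, mul_assoc]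
    gcongr
    refine (lintegral_mono fun t => hfB t).trans_eq ?_
    rw [setLIntegral_const, mul_comm]
  · filter_upwards [hρ.ae_tendsto_kantorovich hm hfi] with x hx
    have h := (tendsto_const_nhds (x := f x)).sub (hx.comp (tendsto_add_atTop_nat 1))
    rw [sub_self] at h
    simpa using! h.enorm

/-- The error is dominated by `|f|` and vanishes at each point once `N ≥ |f x|`. -/
lemma tendsto_mixedNorm_truncation {r : ℕ} {p : Fin r → ℝ} (hp : ∀ i, 1 ≤ p i)
    {f : (Fin r → ℝ) → ℝ} (hf : Measurable f) (h : mixedNorm p f < ∞) :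
    Tendsto (fun N : ℕ => mixedNorm p (fun x => f x - {x | |f x| ≤ N}.indicator f x))
      atTop (𝓝 0) := by
  refine tendsto_mixedNormAux_of_dominated hp (G := fun x => ‖f x‖ₑ) (fun N => ?_) hf.enorm h
    (fun N => ae_of_all _ fun x => ?_) (ae_of_all _ fun x => ?_)
  · exact (hf.sub (hf.indicator (measurableSet_le hf.norm measurable_const))).enorm
  · by_cases hx : x ∈ {x | |f x| ≤ N} <;> simp [hx]
  · refine tendsto_const_nhds.congr' ?_
    filter_upwards [eventually_ge_atTop (⌈|f x|⌉₊)] with N hN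
    have hx : x ∈ {x | |f x| ≤ N} := Nat.ceil_le.1 hN
    simp [hx]

/-- Convergence for measurable functions vanishing outside the cube. -/
lemma SigmoidalClass.tendsto_of_measurable {m : ℝ} {ρ : ℝ → ℝ} (hρ : SigmoidalClass m ρ)
    (hm : 0 ≤ m) {r : ℕ} {p : Fin r → ℝ} (hp : ∀ i, 1 ≤ p i)
    {f : (Fin r → ℝ) → ℝ} (hf : Measurable f) (hf0 : ∀ x ∉ cube r, f x = 0)
    (h : mixedNorm p f < ∞) :
    Tendsto (fun n : ℕ => mixedNorm p (fun x => f x - kantorovich ρ n f x)) atTop (𝓝 0) := by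
  set C := ENNReal.ofReal ((2 * (m + 2)) ^ r) with hC
  rw [ENNReal.tendsto_nhds_zero]
  intro ε hε
  -- One half is for the bounded part `g`; the other covers `f - g` and its image under `K_n`, hence
  -- the factor `1 + C`.
  have hε2 : 0 < ε / 2 := ENNReal.half_pos hε.ne'
  have htr := ENNReal.Tendsto.const_mul (a := 1 + C) (tendsto_mixedNorm_truncation hp hf h)
    (Or.inr (by finiteness))
  rw [mul_zero] at htr
  obtain ⟨N, hN⟩ := ((ENNReal.tendsto_nhds_zero.1 htr) _ hε2).exists
  set g := {x | |f x| ≤ N}.indicator f with hg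
  have hgm : Measurable g := hf.indicator (measurableSet_le hf.norm measurable_const)
  have hg0 : ∀ x ∉ cube r, g x = 0 := fun x hx => by simp [hg, hf0 x hx]
  have hgB : ∀ x, ‖g x‖ₑ ≤ ENNReal.ofReal N := fun x => by
    rw [← ofReal_norm]
    refine ENNReal.ofReal_le_ofReal ?_
    by_cases hx : x ∈ {x | |f x| ≤ N}
    · simpa [hg, Set.indicator_of_mem hx] using hx
    · simp [hg, Set.indicator_of_notMem hx]
  have hfi := integrable_of_mixedNorm_lt_top hp hf hf0 h
  have hgi : Integrable g := hfi.indicator (measurableSet_le hf.norm measurable_const)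
  filter_upwards [ENNReal.tendsto_nhds_zero.1
    (hρ.tendsto_of_bounded hm hp hgm hg0 ENNReal.ofReal_lt_top hgB) _ hε2,
    eventually_gt_atTop 0] with n hn hn0
  have hdm : Measurable fun x => f x - g x := hf.sub hgm
  have hsplit : (fun x => f x - kantorovich ρ n f x) = fun x => (f x - g x) +
      ((g x - kantorovich ρ n g x) + -kantorovich ρ n (fun t => f t - g t) x) := by
    funext x
    rw [kantorovich_sub ρ (fun _ _ => hfi.integrableOn) (fun _ _ => hgi.integrableOn)]
    ring
  calc mixedNorm p (fun x => f x - kantorovich ρ n f x)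
      ≤ mixedNorm p (fun x => f x - g x) + (mixedNorm p (fun x => g x - kantorovich ρ n g x) +
          mixedNorm p (fun x => -kantorovich ρ n (fun t => f t - g t) x)) := by
        rw [hsplit]
        have h1 : Measurable fun x => g x - kantorovich ρ n g x :=
          hgm.sub (hρ.measurable_kantorovich n g)
        have h2 : Measurable fun x => -kantorovich ρ n (fun t => f t - g t) x :=
          (hρ.measurable_kantorovich n _).neg
        exact (mixedNorm_add_le hp hdm (h1.add h2)).trans
          (add_le_add le_rfl (mixedNorm_add_le hp h1 h2))
    _ ≤ mixedNorm p (fun x => f x - g x) + (ε / 2 + C * mixedNorm p (fun x => f x - g x)) := by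
        gcongr
        have := hρ.mixedNorm_kantorovich_le hm hn0 hp hdm
          (fun x hx => by simp [hf0 x hx, hg0 x hx])
        simpa only [mixedNorm, enorm_neg] using this
    _ = (1 + C) * mixedNorm p (fun x => f x - g x) + ε / 2 := by ring
    _ ≤ ε / 2 + ε / 2 := by gcongr
    _ = ε := ENNReal.add_halves ε

end KantorovichNN

theorem theorem3p3 (r : ℕ) (p : Fin r → ℝ) (hp : ∀ i, 1 ≤ p i)
    (m : ℝ) (hm : 0 ≤ m) (ρ : ℝ → ℝ) (hρ : KantorovichNN.SigmoidalClass m ρ)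
    (f : (Fin r → ℝ) → ℝ) (hf : KantorovichNN.MemMixedLp p f) :
    Tendsto (fun n : ℕ => KantorovichNN.mixedNorm p (fun x => f x - KantorovichNN.kantorovich ρ n f x))
      atTop (𝓝 0) := by
  open KantorovichNN in
  obtain ⟨hfm, hft⟩ := hf
  -- The mixed norm, and `K_n` for `n > 0`, depend only on the a.e. class on the cube, so `f` may be
  -- replaced by a measurable function vanishing outside it.
  set g : (Fin r → ℝ) → ℝ := (cube r).indicator (hfm.mk f) with hg
  have hfg : f =ᵐ[volume.restrict (cube r)] g := by
    filter_upwards [hfm.ae_eq_mk, ae_restrict_mem (measurableSet_cube r)] with x hx hxc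
    rw [hg, Set.indicator_of_mem hxc, hx]
  have hgt : mixedNorm p g < ∞ := by
    rwa [mixedNorm, ← mixedNormAux_congr_ae hp (F := fun x => ‖f x‖ₑ)
      (hfg.mono fun x hx => by rw [hx])]
  refine (hρ.tendsto_of_measurable hm hp (hfm.measurable_mk.indicator (measurableSet_cube r))
    (fun x hx => Set.indicator_of_notMem hx _) hgt).congr' ?_
  filter_upwards [eventually_gt_atTop 0] with n hn
  refine mixedNormAux_congr_ae hp ?_
  filter_upwards [hfg] with x hx
  rw [kantorovich_congr_ae ρ hn hfg, hx]
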